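/- Let $K$ be an infinite field, $P=K[x_1,\dots,x_n]$ with its standard grading, and $P_1$ the space of linear forms. A \emph{distraction matrix} is an infinite matrix $\mathcal L=(L_{ij}\mid 1\le i\le n,\ j\ge 1)$ with entries in $P_1$ such that (a) $L_{1j_1},\dots,L_{nj_n}$ span $P_1$ for all $j_1,\dots,j_n\ge 1$, and (b) there is $N\ge 1$ with $L_{ij}=L_{iN}$ for all $i$ and all $j>N$. The $K$-linear operator $D_{\mathcal L}:P\to P$ is defined on power products by $$D_{\mathcal L}(x_1^{\alpha_1}\cdots x_n^{\alpha_n})=\prod_{i=1}^n\prod_{j=1}^{\alpha_i}L_{ij}$$ and extended by linearity. An ideal of $P$ is \emph{monomial} if it is spanned as a $K$-vector space by power products; a monomial ideal $I$ is \emph{strongly stable} if $x_i t/x_j\in I$ for every power product $t\in I$, every $x_j$ dividing $t$ and every $i\le j$. Let $\mathrm{in}_{\mathrm{drl}}(J)$ be the ideal generated by the leading power products of the nonzero elements of $J$ with respect to the degree reverse lexicographic ordering with $x_1>x_2>\cdots>x_n$. A matrix $g=(g_{ij})\in \mathrm{GL}(n,K)$ acts on $P$ by the $K$-algebra automorphism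 $x_j\mapsto\sum_i g_{ij}x_i$. The \emph{generic initial ideal} $\mathrm{gin}_{\mathrm{drl}}(J)$ of a homogeneous ideal $J$ is the unique ideal equal to $\mathrm{in}_{\mathrm{drl}}(g(J))$ for all $g$ in some nonempty Zariski open subset of $\mathrm{GL}(n,K)$. \textbf{Theorem.} Let $I\subseteq P$ be a strongly stable monomial ideal and let $\mathcal L$ be a distraction matrix. Then the vector space $D_{\mathcal L}(I)$ is a homogeneous ideal of $P$, and $$\mathrm{gin}_{\mathrm{drl}}\big(D_{\mathcal L}(I)\big)=I.$$ -/

import Mathlib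

open MvPolynomial

namespace GinDistraction

/-! ## The degree reverse lexicographic ordering

The indeterminates `x_1 > x_2 > ⋯ > x_n` are `X 0, …, X (n-1)`, indexed by `Fin n`. -/

/-- Exponent vectors of power products in `n` indeterminates, to be ordered by `DegRevLex`. -/
def DegRevLex (n : ℕ) : Type := Fin n →₀ ℕ

noncomputable instance (n : ℕ) : AddCommMonoid (DegRevLex n) :=
  inferInstanceAs (AddCommMonoid (Fin n →₀ ℕ))

/-- The identity map. -/
noncomputable def toDRL (n : ℕ) : (Fin n →₀ ℕ) ≃+ DegRevLex n where
  toFun a := a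
  invFun a := a
  left_inv _ := rfl
  right_inv _ := rfl
  map_add' _ _ := rfl

/-- Compare first the degrees, then the exponents of `x_n, x_{n-1}, …, x_1` in this order;
at the first difference the larger exponent belongs to the smaller power product. -/
noncomputable def drlKey (n : ℕ) (a : Fin n →₀ ℕ) : ℕ ×ₗ Lex (Fin n → ℕᵒᵈ) :=
  toLex (a.degree, toLex fun i => OrderDual.toDual (a i.rev))

theorem drlKey_injective (n : ℕ) : Function.Injective (drlKey n) := by
  intro a b h
  ext i
  have h2 := congrFun (congrArg (fun z => ofLex (ofLex z).2) h) i.rev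
  simpa [drlKey] using h2

noncomputable instance (n : ℕ) : LinearOrder (DegRevLex n) :=
  LinearOrder.lift' (drlKey n) (drlKey_injective n)

theorem drl_lt_iff {n : ℕ} (a b : Fin n →₀ ℕ) :
    toDRL n a < toDRL n b ↔
      a.degree < b.degree ∨ (a.degree = b.degree ∧ ∃ i, (∀ j, i < j → a j = b j) ∧ b i < a i) := by
  change drlKey n a < drlKey n b ↔ _
  rw [drlKey, drlKey, Prod.Lex.toLex_lt_toLex]
  refine or_congr Iff.rfl (and_congr Iff.rfl ?_)
  constructor
  · rintro ⟨i, h1, h2⟩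
    refine ⟨i.rev, fun j hj => ?_, h2⟩
    have hj' : j.rev < i := by rwa [← Fin.rev_lt_rev, Fin.rev_rev]
    simpa using h1 j.rev hj'
  · rintro ⟨i, h1, h2⟩
    refine ⟨i.rev, fun j hj => ?_, ?_⟩
    · have := h1 j.rev (by rwa [← Fin.rev_lt_rev, Fin.rev_rev])
      simpa using this
    · change b i.rev.rev < a i.rev.rev
      simpa using h2

instance (n : ℕ) : IsOrderedAddMonoid (DegRevLex n) where
  add_le_add_left a b hab c := by
    obtain ⟨a, rfl⟩ := (toDRL n).surjective a
    obtain ⟨b, rfl⟩ := (toDRL n).surjective b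
    obtain ⟨c, rfl⟩ := (toDRL n).surjective c
    rcases hab.eq_or_lt with h | h
    · rw [h]
    · rw [← map_add, ← map_add]
      refine le_of_lt ((drl_lt_iff _ _).2 ?_)
      rcases (drl_lt_iff _ _).1 h with h | ⟨h, i, h1, h2⟩
      · exact Or.inl (by simpa using h)
      · exact Or.inr ⟨by simpa using h, i, fun j hj => by simp [h1 j hj], by simpa using h2⟩

theorem drl_monotone (n : ℕ) :
    Monotone (toDRL n) := by
  intro a b hab
  rcases hab.eq_or_lt with rfl | h
  · exact le_rfl
  · refine le_of_lt ((drl_lt_iff _ _).2 (Or.inl ?_))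
    obtain ⟨c, rfl⟩ := exists_add_of_le hab
    have hc : c ≠ 0 := by rintro rfl; simp at h
    rw [map_add]
    have : c.degree ≠ 0 := by rwa [Ne, Finsupp.degree_eq_zero_iff]
    omega

instance (n : ℕ) : WellFoundedLT (DegRevLex n) := by
  have : WellQuasiOrderedLE (DegRevLex n) :=
    (drl_monotone n).wellQuasiOrderedLE_of_wellQuasiOrderedLE_of_surjective (toDRL n).surjective
  infer_instance

/-- The term ordering `DegRevLex` with `x_1 > x_2 > ⋯ > x_n`. -/
noncomputable def degRevLex (n : ℕ) : MonomialOrder (Fin n) where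
  syn := DegRevLex n
  toSyn := toDRL n
  toSyn_monotone := drl_monotone n

variable {K : Type*} [Field K] {n : ℕ}

/-! ## Monomial and strongly stable ideals -/

/-- An ideal is monomial if, as a `K`-vector space, it is spanned by power products. -/
def IsMonomialIdeal (I : Ideal (MvPolynomial (Fin n) K)) : Prop :=
  ∃ T : Set (Fin n →₀ ℕ),
    I.restrictScalars K = Submodule.span K ((fun t => monomial t (1 : K)) '' T)

/-- A monomial ideal `I` is strongly stable if `x_i t / x_j ∈ I` for every power product `t ∈ I`,
every `x_j` dividing `t` and every `i ≤ j`. -/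
structure IsStronglyStable (I : Ideal (MvPolynomial (Fin n) K)) : Prop where
  isMonomialIdeal : IsMonomialIdeal I
  exchange : ∀ t : Fin n →₀ ℕ, monomial t (1 : K) ∈ I → ∀ j, t j ≠ 0 → ∀ i, i ≤ j →
    monomial (t - Finsupp.single j 1 + Finsupp.single i 1) (1 : K) ∈ I

/-! ## Distractions -/

/-- A distraction matrix. Rows are indexed by the indeterminates; the columns `1, 2, 3, …` are
indexed by `0, 1, 2, …`, so that `L i j` is the entry `L_{i+1, j+1}`. -/
structure IsDistractionMatrix (L : Fin n → ℕ → MvPolynomial (Fin n) K) : Prop where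
  linear : ∀ i j, L i j ∈ homogeneousSubmodule (Fin n) K 1
  span_eq : ∀ j : Fin n → ℕ,
    Submodule.span K (Set.range fun i => L i (j i)) = homogeneousSubmodule (Fin n) K 1
  eventually_const : ∃ N : ℕ, ∀ i j, N < j → L i j = L i N

/-- The distraction `∏_i ∏_{j=1}^{t_i} L_{ij}` of the power product with exponents `t`. -/
noncomputable def distractionMonomial (L : Fin n → ℕ → MvPolynomial (Fin n) K)
    (t : Fin n →₀ ℕ) : MvPolynomial (Fin n) K :=
  ∏ i, ∏ j ∈ Finset.range (t i), L i j

/-- The operator `D_L`: the linear extension of the distraction of power products. -/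
noncomputable def distraction (L : Fin n → ℕ → MvPolynomial (Fin n) K) :
    MvPolynomial (Fin n) K →ₗ[K] MvPolynomial (Fin n) K :=
  (basisMonomials (Fin n) K).constr K (distractionMonomial L)

/-! ## Initial and generic initial ideals -/

/-- The initial ideal of `I`: generated by the leading power products of the nonzero `f ∈ I`. -/
noncomputable def initialIdeal (σ : MonomialOrder (Fin n)) (I : Ideal (MvPolynomial (Fin n) K)) :
    Ideal (MvPolynomial (Fin n) K) :=
  Ideal.span {p | ∃ f ∈ I, f ≠ 0 ∧ p = monomial (σ.degree f) 1}

/-- The action of `g ∈ GL(n, K)` on polynomials, `x_j ↦ ∑ i, g i j * x_i`. -/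
noncomputable def linearChange (g : GL (Fin n) K) :
    MvPolynomial (Fin n) K →ₐ[K] MvPolynomial (Fin n) K :=
  aeval fun j => ∑ i, C (g i j) * X i

/-- `p g` holds for a generic `g ∈ GL(n, K)`: it holds on a nonempty basic Zariski open subset,
i.e. at every `g` where some polynomial `F` in the matrix entries, not vanishing identically on
`GL(n, K)`, is nonzero. -/
def ForGeneric (p : GL (Fin n) K → Prop) : Prop :=
  ∃ F : MvPolynomial (Fin n × Fin n) K,
    (∃ g : GL (Fin n) K, eval (fun ij => g ij.1 ij.2) F ≠ 0) ∧
      ∀ g : GL (Fin n) K, eval (fun ij => g ij.1 ij.2) F ≠ 0 → p g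

/-- `G` is the `σ`-generic initial ideal of `I`: `in_σ(g(I)) = G` for a generic `g`. (As `g` acts
by an automorphism, `Ideal.map` is the image of `I`.) -/
def IsGenericInitialIdeal (σ : MonomialOrder (Fin n)) (I G : Ideal (MvPolynomial (Fin n) K)) :
    Prop :=
  ForGeneric fun g : GL (Fin n) K => initialIdeal σ (I.map (linearChange g)) = G

/-- Over an infinite field two generic properties hold together at some `g`. -/
theorem ForGeneric.exists_and [Infinite K] {p q : GL (Fin n) K → Prop}
    (hp : ForGeneric p) (hq : ForGeneric q) : ∃ g, p g ∧ q g := by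
  obtain ⟨F, ⟨g₁, h₁⟩, hF⟩ := hp
  obtain ⟨H, ⟨g₂, h₂⟩, hH⟩ := hq
  let Δ : MvPolynomial (Fin n × Fin n) K := (Matrix.of fun i j => X (i, j)).det
  have hΔ (x : Fin n × Fin n → K) : eval x Δ = (Matrix.of fun i j => x (i, j)).det := by
    simp only [Δ, RingHom.map_det]
    congr 1
    ext i j
    simp
  have F0 : F ≠ 0 := by rintro rfl; simp at h₁
  have H0 : H ≠ 0 := by rintro rfl; simp at h₂
  have D0 : Δ ≠ 0 := by
    intro h
    have := hΔ fun ij => (1 : Matrix (Fin n) (Fin n) K) ij.1 ij.2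
    rw [h, map_zero] at this
    exact one_ne_zero (this.trans Matrix.det_one).symm
  have : ∃ x, eval x (F * H * Δ) ≠ 0 := by
    by_contra! h
    exact mul_ne_zero (mul_ne_zero F0 H0) D0 (MvPolynomial.funext fun x => by rw [h x, map_zero])
  obtain ⟨x, hx⟩ := this
  rw [map_mul, map_mul, hΔ] at hx
  have hd := right_ne_zero_of_mul hx
  refine ⟨Matrix.GeneralLinearGroup.mkOfDetNeZero _ hd, hF _ ?_, hH _ ?_⟩
  · exact left_ne_zero_of_mul (left_ne_zero_of_mul hx)
  · exact right_ne_zero_of_mul (left_ne_zero_of_mul hx)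

/-- The generic initial ideal is unique. -/
theorem IsGenericInitialIdeal.unique [Infinite K] {σ : MonomialOrder (Fin n)}
    {I G G' : Ideal (MvPolynomial (Fin n) K)} (h : IsGenericInitialIdeal σ I G)
    (h' : IsGenericInitialIdeal σ I G') : G = G' := by
  obtain ⟨g, hg, hg'⟩ := h.exists_and h'
  exact hg.symm.trans hg'

end GinDistraction

namespace GinDistraction

variable {K : Type*} [Field K] {n : ℕ}

/-! Write `M = g(L)` for a generic `g`; the image of the distraction of `I` under `g` is the
distraction of `I` by `M`. The core (`monomial_mem_sup`) is that every power product `t ∈ I` is the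
leading one of some element of this ideal. The rows of `M` are replaced by constant rows of
indeterminates one at a time, from the last to the first, which turns the distraction of `t` into
`t` itself. Replacing row `k` means expressing `x_k` through the forms that come next in each row.
Terms using a row `r ≤ k` exchange `x_k` for `x_r` and stay in `I` by strong stability. Terms using
a row `r > k` gain a factor `x_r`, hence are smaller for degrevlex (`mul_X_pow_mem_sup`).

There are no other leading power products, by counting: in degree `d` the distraction of `I` is
spanned by as many elements as `I` has power products of degree `d`, and these already occur as
leading ones (`mem_of_leading`).

The exchanges need every choice of one form per row, in each of the mixed matrices, to span the
linear forms. By eventual constancy these are finitely many determinants, each a nonzero polynomial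
in the entries of `g` (`det_mixedMatrix_ne_zero`). -/

/-- The exponent vectors of the power products in `I`. -/
def exponents (I : Ideal (MvPolynomial (Fin n) K)) : Set (Fin n →₀ ℕ) :=
  {t | monomial t (1 : K) ∈ I}

theorem add_single_mem_exponents {I : Ideal (MvPolynomial (Fin n) K)} {t : Fin n →₀ ℕ}
    (ht : t ∈ exponents I) (i : Fin n) : t + Finsupp.single i 1 ∈ exponents I := by
  have := I.mul_mem_right (X i) ht
  rwa [X, monomial_mul, one_mul] at this

theorem IsMonomialIdeal.restrictScalars_eq_span {I : Ideal (MvPolynomial (Fin n) K)}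
    (hI : IsMonomialIdeal I) :
    I.restrictScalars K = Submodule.span K ((fun t => monomial t (1 : K)) '' exponents I) := by
  obtain ⟨T, hT⟩ := hI
  refine le_antisymm ?_ (Submodule.span_le.2 ?_)
  · rw [hT]
    refine Submodule.span_mono (Set.image_mono fun t ht => ?_)
    have : monomial t (1 : K) ∈ I.restrictScalars K := by
      rw [hT]
      exact Submodule.subset_span ⟨t, ht, rfl⟩
    exact this
  · rintro _ ⟨t, ht, rfl⟩
    exact ht

theorem IsMonomialIdeal.le_of_exponents_subset {I J : Ideal (MvPolynomial (Fin n) K)}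
    (hI : IsMonomialIdeal I) (h : exponents I ⊆ exponents J) : I ≤ J := by
  have : I.restrictScalars K ≤ J.restrictScalars K := by
    rw [hI.restrictScalars_eq_span, Submodule.span_le]
    rintro _ ⟨t, ht, rfl⟩
    exact h ht
  exact this

/-! ## Distractions of monomial ideals -/

theorem distraction_monomial (L : Fin n → ℕ → MvPolynomial (Fin n) K) (t : Fin n →₀ ℕ) :
    distraction L (monomial t 1) = distractionMonomial L t := by
  have := (basisMonomials (Fin n) K).constr_basis K (distractionMonomial L) t
  rwa [coe_basisMonomials] at this

theorem distractionMonomial_add_single (L : Fin n → ℕ → MvPolynomial (Fin n) K)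
    (t : Fin n →₀ ℕ) (i : Fin n) :
    distractionMonomial L (t + Finsupp.single i 1) = distractionMonomial L t * L i (t i) := by
  have h : L i (t i) = ∏ r, if r = i then L i (t i) else 1 := by simp
  rw [distractionMonomial, distractionMonomial, h, ← Finset.prod_mul_distrib]
  refine Finset.prod_congr rfl fun r _ => ?_
  by_cases hr : r = i
  · subst hr
    simp [Finset.prod_range_succ]
  · simp [hr]

theorem isHomogeneous_distractionMonomial {L : Fin n → ℕ → MvPolynomial (Fin n) K}
    (hL : ∀ i j, (L i j).IsHomogeneous 1) (t : Fin n →₀ ℕ) :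
    (distractionMonomial L t).IsHomogeneous t.degree := by
  have := IsHomogeneous.prod Finset.univ (fun i => ∏ j ∈ Finset.range (t i), L i j) t
    fun i _ => by
      have := IsHomogeneous.prod (Finset.range (t i)) (fun j => L i j) (fun _ => 1)
        fun j _ => hL i j
      simpa using this
  rwa [← Finsupp.degree_eq_sum] at this

/-- The rows of `L` can be combined to any indeterminate, whatever entries are chosen. -/
def RowsSpan (L : Fin n → ℕ → MvPolynomial (Fin n) K) : Prop :=
  ∀ (j : Fin n → ℕ) (i : Fin n), X i ∈ Submodule.span K (Set.range fun r => L r (j r))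

/-- In row `r` the entry `L r (t r)` is the next factor after those in the distraction of `t`.
Writing `X i` in terms of these entries turns multiplication by `X i` into raising single exponents.
-/
theorem RowsSpan.exists_distractionMonomial_mul_X {L : Fin n → ℕ → MvPolynomial (Fin n) K}
    (hL : RowsSpan L) (t : Fin n →₀ ℕ) (i : Fin n) :
    ∃ c : Fin n → K, distractionMonomial L t * X i =
      ∑ r, c r • distractionMonomial L (t + Finsupp.single r 1) := by
  obtain ⟨c, hc⟩ := (Submodule.mem_span_range_iff_exists_fun K).1 (hL t i)
  refine ⟨c, ?_⟩
  rw [← hc, Finset.mul_sum]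
  refine Finset.sum_congr rfl fun r _ => ?_
  rw [distractionMonomial_add_single, mul_smul_comm]

/-- The span of the distractions of the power products in `I`, as an ideal. -/
noncomputable def distractionIdeal (L : Fin n → ℕ → MvPolynomial (Fin n) K) (hL : RowsSpan L)
    (I : Ideal (MvPolynomial (Fin n) K)) : Ideal (MvPolynomial (Fin n) K) where
  __ := Submodule.span K (distractionMonomial L '' exponents I)
  smul_mem' p f hf := by
    set V := Submodule.span K (distractionMonomial L '' exponents I) with hV
    change f ∈ V at hf
    change p * f ∈ V
    have hX : ∀ i, ∀ f ∈ V, f * X i ∈ V := by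
      intro i f hf
      induction hf using Submodule.span_induction with
      | mem x hx =>
        obtain ⟨t, ht, rfl⟩ := hx
        obtain ⟨c, hc⟩ := hL.exists_distractionMonomial_mul_X t i
        rw [hc]
        exact Submodule.sum_mem _ fun r _ => Submodule.smul_mem _ _ <|
          Submodule.subset_span ⟨_, add_single_mem_exponents ht r, rfl⟩
      | zero => simp
      | add x y _ _ hx hy => rw [add_mul]; exact V.add_mem hx hy
      | smul a x _ hx => rw [smul_mul_assoc]; exact V.smul_mem a hx
    induction p using MvPolynomial.induction_on with
    | C a => rw [C_mul']; exact V.smul_mem a hf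
    | add p q hp hq => rw [add_mul]; exact V.add_mem hp hq
    | mul_X p i hp => rw [mul_right_comm]; exact hX i _ hp

theorem mem_distractionIdeal {L : Fin n → ℕ → MvPolynomial (Fin n) K} {hL : RowsSpan L}
    {I : Ideal (MvPolynomial (Fin n) K)} {f : MvPolynomial (Fin n) K} :
    f ∈ distractionIdeal L hL I ↔ f ∈ Submodule.span K (distractionMonomial L '' exponents I) :=
  Iff.rfl

theorem map_distraction {I : Ideal (MvPolynomial (Fin n) K)} (hI : IsMonomialIdeal I)
    (L : Fin n → ℕ → MvPolynomial (Fin n) K) :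
    (I.restrictScalars K).map (distraction L) =
      Submodule.span K (distractionMonomial L '' exponents I) := by
  rw [hI.restrictScalars_eq_span, Submodule.map_span, Set.image_image]
  simp_rw [distraction_monomial]

/-- The homogeneous component of degree `d` of an element of the distraction of `I` is spanned
by the distractions of the power products of degree `d`. -/
theorem homogeneousComponent_mem_span {L : Fin n → ℕ → MvPolynomial (Fin n) K}
    (hL : ∀ i j, (L i j).IsHomogeneous 1) {I : Ideal (MvPolynomial (Fin n) K)}
    {f : MvPolynomial (Fin n) K}
    (hf : f ∈ Submodule.span K (distractionMonomial L '' exponents I)) (d : ℕ) :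
    homogeneousComponent d f ∈
      Submodule.span K (distractionMonomial L '' {t ∈ exponents I | t.degree = d}) := by
  induction hf using Submodule.span_induction with
  | mem x hx =>
    obtain ⟨t, ht, rfl⟩ := hx
    rw [homogeneousComponent_of_mem (isHomogeneous_distractionMonomial hL t)]
    split_ifs with h
    · exact Submodule.subset_span ⟨t, ⟨ht, h.symm⟩, rfl⟩
    · exact Submodule.zero_mem _
  | zero => simp
  | add x y _ _ hx hy => rw [map_add]; exact Submodule.add_mem _ hx hy
  | smul a x _ hx => rw [map_smul]; exact Submodule.smul_mem _ a hx

theorem homogeneousComponent_mem_distractionIdeal {L : Fin n → ℕ → MvPolynomial (Fin n) K}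
    (hL : ∀ i j, (L i j).IsHomogeneous 1) {hs : RowsSpan L} {I : Ideal (MvPolynomial (Fin n) K)}
    {f : MvPolynomial (Fin n) K} (hf : f ∈ distractionIdeal L hs I) (d : ℕ) :
    homogeneousComponent d f ∈ distractionIdeal L hs I :=
  Submodule.span_mono (Set.image_mono fun _ h => h.1) (homogeneousComponent_mem_span hL hf d)

theorem linearChange_distractionMonomial (g : GL (Fin n) K)
    (L : Fin n → ℕ → MvPolynomial (Fin n) K) (t : Fin n →₀ ℕ) :
    linearChange g (distractionMonomial L t) =
      distractionMonomial (fun i j => linearChange g (L i j)) t := by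
  simp [distractionMonomial, map_prod]

/-- The `K`-linear image of the span is the span for the transformed matrix; it is already an ideal
by `hM`, so `Ideal.map` adds nothing to it. -/
theorem map_distractionIdeal (g : GL (Fin n) K) {L : Fin n → ℕ → MvPolynomial (Fin n) K}
    (hL : RowsSpan L) (hM : RowsSpan fun i j => linearChange g (L i j))
    (I : Ideal (MvPolynomial (Fin n) K)) :
    (distractionIdeal L hL I).map (linearChange g) =
      distractionIdeal (fun i j => linearChange g (L i j)) hM I := by
  have key : Submodule.span K
        (distractionMonomial (fun i j => linearChange g (L i j)) '' exponents I) =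
      (Submodule.span K (distractionMonomial L '' exponents I)).map
        (linearChange g).toLinearMap := by
    rw [Submodule.map_span, Set.image_image]
    simp [linearChange_distractionMonomial]
  refine le_antisymm (Ideal.map_le_iff_le_comap.2 fun f hf => ?_) fun f hf => ?_
  · rw [Ideal.mem_comap, mem_distractionIdeal, key]
    exact Submodule.mem_map_of_mem (f := (linearChange g).toLinearMap) hf
  · rw [mem_distractionIdeal, key] at hf
    obtain ⟨p, hp, rfl⟩ := hf
    exact Ideal.mem_map_of_mem _ hp

/-! ## Comparing leading power products by dimension -/

theorem linearIndependent_of_leading (σ : MonomialOrder (Fin n)) {S : Set (Fin n →₀ ℕ)}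
    (f : S → MvPolynomial (Fin n) K) (hf : ∀ s : S, coeff (s : Fin n →₀ ℕ) (f s) ≠ 0)
    (hle : ∀ s : S, ∀ b ∈ (f s).support, σ.toSyn b ≤ σ.toSyn s) : LinearIndependent K f := by
  classical
  rw [linearIndependent_iff']
  intro A c hc
  by_contra! h
  obtain ⟨i, hiA, hi⟩ := h
  -- The largest index with a nonzero coefficient: its power product occurs in no other term of the
  -- relation, so it cannot cancel.
  obtain ⟨m, hm, hmax⟩ := (A.filter fun s => c s ≠ 0).exists_max_image
    (fun s => σ.toSyn (s : Fin n →₀ ℕ)) ⟨i, by simp [hiA, hi]⟩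
  rw [Finset.mem_filter] at hm
  have h0 := congrArg (coeff (m : Fin n →₀ ℕ)) hc
  rw [coeff_sum, coeff_zero, Finset.sum_eq_single_of_mem m hm.1] at h0
  · rw [coeff_smul, smul_eq_mul] at h0
    exact mul_ne_zero hm.2 (hf m) h0
  · intro s hs hsm
    rw [coeff_smul, smul_eq_mul]
    by_cases hcs : c s = 0
    · rw [hcs, zero_mul]
    by_contra hne
    have h1 := hle s m (mem_support_iff.2 (right_ne_zero_of_mul hne))
    have h2 := hmax s (by simp [hs, hcs])
    exact hsm (Subtype.ext (σ.toSyn.injective (le_antisymm h2 h1)))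

/-- A space spanned by as many elements as it has prescribed leading power products has no
other leading power products. -/
theorem mem_of_leading (σ : MonomialOrder (Fin n)) {S : Set (Fin n →₀ ℕ)} (hS : S.Finite)
    (u : (Fin n →₀ ℕ) → MvPolynomial (Fin n) K)
    (h : ∀ s ∈ S, ∃ f ∈ Submodule.span K (u '' S),
      coeff s f ≠ 0 ∧ ∀ b ∈ f.support, σ.toSyn b ≤ σ.toSyn s)
    {m : Fin n →₀ ℕ} {f : MvPolynomial (Fin n) K} (hf : f ∈ Submodule.span K (u '' S))
    (hm : coeff m f ≠ 0) (hle : ∀ b ∈ f.support, σ.toSyn b ≤ σ.toSyn m) : m ∈ S := by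
  classical
  by_contra hmS
  set V := Submodule.span K (u '' S)
  -- If `m` were new, `V` would contain `|S| + 1` independent elements while being spanned by at
  -- most `|S|`.
  have h' : ∀ s : ↥(insert m S), ∃ f ∈ V,
      coeff (s : Fin n →₀ ℕ) f ≠ 0 ∧ ∀ b ∈ f.support, σ.toSyn b ≤ σ.toSyn s := by
    rintro ⟨s, rfl | hs⟩
    · exact ⟨f, hf, hm, hle⟩
    · exact h s hs
  choose F hFV hF0 hFle using h'
  have hli := linearIndependent_of_leading σ F hF0 hFle
  have hfin : (u '' S).Finite := hS.image u
  have : Module.Finite K V := Module.Finite.span_of_finite K hfin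
  have : Fintype ↥(insert m S) := (hS.insert m).fintype
  have hli' : LinearIndependent K fun s => (⟨F s, hFV s⟩ : V) :=
    LinearIndependent.of_comp V.subtype hli
  have h1 := hli'.fintype_card_le_finrank
  have h2 : Module.finrank K V ≤ S.ncard := by
    have := hfin.fintype
    refine (finrank_span_le_card (R := K) (u '' S)).trans ?_
    rw [← Set.ncard_eq_toFinset_card']
    exact Set.ncard_image_le hS
  rw [← Nat.card_eq_fintype_card, Nat.card_coe_set_eq, Set.ncard_insert_of_notMem hmS hS] at h1
  omega

/-! ## Leading power products of distractions -/

/-- The first `k` rows of `M`, followed by constant rows `x_{k+1}, …, x_n`. -/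
noncomputable def mixedRows (M : Fin n → ℕ → MvPolynomial (Fin n) K) (k : ℕ) :
    Fin n → ℕ → MvPolynomial (Fin n) K :=
  fun r j => if (r : ℕ) < k then M r j else X r

theorem mixedRows_zero (M : Fin n → ℕ → MvPolynomial (Fin n) K) (t : Fin n →₀ ℕ) :
    distractionMonomial (mixedRows M 0) t = monomial t 1 := by
  rw [monomial_eq, C_1, one_mul, Finsupp.prod_fintype _ _ fun _ => pow_zero _]
  simp [distractionMonomial, mixedRows]

theorem mixedRows_self (M : Fin n → ℕ → MvPolynomial (Fin n) K) : mixedRows M n = M := by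
  funext r j
  simp [mixedRows]

theorem isHomogeneous_mixedRows {M : Fin n → ℕ → MvPolynomial (Fin n) K}
    (hM : ∀ i j, (M i j).IsHomogeneous 1) (k : ℕ) (i : Fin n) (j : ℕ) :
    (mixedRows M k i j).IsHomogeneous 1 := by
  rw [mixedRows]
  split_ifs
  exacts [hM i j, isHomogeneous_X K i]

/-- The exponent vectors of the same degree as `a` that first differ from `a`, read from the end
and disregarding the first `k` positions, in an exponent that is larger. -/
def tailLarger (k : ℕ) (a : Fin n →₀ ℕ) : Set (Fin n →₀ ℕ) :=
  {b | b.degree = a.degree ∧ ∃ i : Fin n, k ≤ i ∧ a i < b i ∧ ∀ j, i < j → b j = a j}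

theorem tailLarger_subset {k : ℕ} {a a' : Fin n →₀ ℕ} (hdeg : a'.degree = a.degree)
    (h : ∀ i : Fin n, k < i → a' i = a i) : tailLarger (k + 1) a' ⊆ tailLarger k a := by
  rintro b ⟨hb, i, hi, hlt, heq⟩
  refine ⟨hb.trans hdeg, i, by omega, by rwa [← h i hi], fun j hj => ?_⟩
  rw [heq j hj, h j (by have : (i : ℕ) < j := hj; omega)]

theorem mem_tailLarger {k : ℕ} {a b : Fin n →₀ ℕ} (hdeg : b.degree = a.degree)
    (hle : ∀ i : Fin n, k ≤ i → a i ≤ b i) (hlt : ∃ i : Fin n, k ≤ i ∧ a i < b i) :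
    b ∈ tailLarger k a := by
  classical
  obtain ⟨i₀, hi₀⟩ := hlt
  obtain ⟨m, hm, hmax⟩ := (Finset.univ.filter fun i : Fin n => k ≤ i ∧ a i < b i).exists_max_image
    id ⟨i₀, by simpa using hi₀⟩
  simp only [Finset.mem_filter, Finset.mem_univ, true_and, id] at hm hmax
  refine ⟨hdeg, m, hm.1, hm.2, fun j hj => ?_⟩
  have hkj : k ≤ j := hm.1.trans (le_of_lt hj)
  by_contra hne
  exact absurd (hmax j ⟨hkj, lt_of_le_of_ne (hle j hkj) (Ne.symm hne)⟩) (not_le.2 hj)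

theorem toSyn_lt_of_mem_tailLarger {a b : Fin n →₀ ℕ} (h : b ∈ tailLarger 0 a) :
    (degRevLex n).toSyn b < (degRevLex n).toSyn a := by
  obtain ⟨hdeg, i, -, hlt, heq⟩ := h
  exact (drl_lt_iff b a).2 (Or.inr ⟨hdeg, i, heq, hlt⟩)

/-- Row `i` is constantly `X i`, so the product is divisible by `X i ^ t i`. -/
theorem le_of_mem_support_mixedRows {M : Fin n → ℕ → MvPolynomial (Fin n) K} {k : ℕ}
    {t b : Fin n →₀ ℕ} (hb : b ∈ (distractionMonomial (mixedRows M k) t).support) {i : Fin n}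
    (hi : k ≤ i) : t i ≤ b i := by
  have h : distractionMonomial (mixedRows M k) t = monomial (Finsupp.single i (t i)) 1 *
      ∏ r ∈ Finset.univ.erase i, ∏ j ∈ Finset.range (t r), mixedRows M k r j := by
    rw [distractionMonomial, ← Finset.mul_prod_erase _ _ (Finset.mem_univ i), ← X_pow_eq_monomial]
    simp [mixedRows, not_lt.2 hi]
  rw [mem_support_iff, h, coeff_monomial_mul'] at hb
  by_contra hlt
  rw [if_neg] at hb
  · exact hb rfl
  · intro hle
    have := hle i
    simp only [Finsupp.single_eq_same] at this
    exact hlt this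

/-- Beyond position `k` the rows are indeterminates, so every power product occurring has exponents
there at least those of `u`, hence at least those of `a`, with one of them strictly larger. -/
theorem mul_X_pow_mem_restrictSupport {M : Fin n → ℕ → MvPolynomial (Fin n) K}
    (hM : ∀ i j, (M i j).IsHomogeneous 1) {k : Fin n} {u a : Fin n →₀ ℕ} {b : ℕ}
    (hdeg : u.degree + b = a.degree) (hle : ∀ i, k < i → a i ≤ u i)
    (hlt : ∃ i, k < i ∧ a i < u i) :
    distractionMonomial (mixedRows M (k + 1)) u * X k ^ b ∈
      restrictSupport K (tailLarger k a) := by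
  rw [mem_restrictSupport_iff]
  intro c hc
  have hhom := (isHomogeneous_distractionMonomial (isHomogeneous_mixedRows hM (k + 1)) u).mul
    ((isHomogeneous_X K k).pow b)
  rw [SetLike.mem_coe, mem_support_iff] at hc
  have hcdeg : c.degree = a.degree := by
    have := hhom.degree_eq_sum_deg_support (mem_support_iff.2 hc)
    rw [← Finsupp.degree_apply] at this
    omega
  rw [mul_comm, X_pow_eq_monomial, coeff_monomial_mul'] at hc
  split_ifs at hc with h
  · rw [one_mul, ← mem_support_iff] at hc
    have hge : ∀ i, k < i → u i ≤ c i := fun i hi => by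
      have := le_of_mem_support_mixedRows hc (i := i) hi
      exact this.trans (by simp)
    -- The exponents are controlled only strictly beyond `k`, so the comparison is made in
    -- `tailLarger (k + 1) a` and then enlarged.
    refine tailLarger_subset rfl (fun i _ => rfl)
      (mem_tailLarger hcdeg (fun i hi => (hle i hi).trans (hge i hi)) ?_)
    obtain ⟨i, hi, hl⟩ := hlt
    exact ⟨i, hi, hl.trans_le (hge i hi)⟩
  · exact absurd rfl hc

/-- The factors `X k` are absorbed one by one into the distraction. The vector `u` changes with each
exchange, while `a` stays fixed as the reference for the error terms: only the degree and the
exponents beyond `k` must agree with it. -/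
theorem mul_X_pow_mem_sup {I : Ideal (MvPolynomial (Fin n) K)} (hI : IsStronglyStable I)
    {M : Fin n → ℕ → MvPolynomial (Fin n) K} (hM : ∀ i j, (M i j).IsHomogeneous 1) {k : Fin n}
    (hs : RowsSpan (mixedRows M (k + 1))) {V : Submodule K (MvPolynomial (Fin n) K)}
    (hV : ∀ t ∈ exponents I, distractionMonomial (mixedRows M (k + 1)) t ∈
      V ⊔ restrictSupport K (tailLarger (k + 1) t)) (a : Fin n →₀ ℕ) (b : ℕ) :
    ∀ u : Fin n →₀ ℕ, u + Finsupp.single k b ∈ exponents I → u.degree + b = a.degree →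
      (∀ i, k < i → u i = a i) →
      distractionMonomial (mixedRows M (k + 1)) u * X k ^ b ∈
        V ⊔ restrictSupport K (tailLarger k a) := by
  induction b with
  | zero =>
    intro u hu hdeg htail
    rw [pow_zero, mul_one]
    exact sup_le_sup_left (restrictSupport_mono (R := K) (tailLarger_subset hdeg htail)) V
      (hV u (by simpa using hu))
  | succ b ih =>
    intro u hu hdeg htail
    obtain ⟨c, hc⟩ := hs.exists_distractionMonomial_mul_X u k
    rw [pow_succ', ← mul_assoc, hc, Finset.sum_mul]
    refine Submodule.sum_mem _ fun r _ => ?_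
    rw [smul_mul_assoc]
    refine Submodule.smul_mem _ _ ?_
    have hdeg' : (u + Finsupp.single r 1).degree + b = a.degree := by
      rw [map_add, Finsupp.degree_single]
      omega
    -- For `r ≤ k` strong stability keeps the exponent vector in `I` and the tail is untouched; for
    -- `r > k` the tail has grown, and the whole product is an error term.
    rcases le_or_gt r k with hr | hr
    · refine ih _ ?_ hdeg' fun i hi => ?_
      · have := hI.exchange _ hu k (by simp) r hr
        have heq : u + Finsupp.single k (b + 1) - Finsupp.single k 1 = u + Finsupp.single k b := by
          rw [Finsupp.single_add, ← add_assoc, add_tsub_cancel_right]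
        rwa [heq, add_right_comm] at this
      · have : r ≠ i := (hr.trans_lt hi).ne
        simp [htail i hi, this]
    · exact Submodule.mem_sup_right <| mul_X_pow_mem_restrictSupport hM hdeg'
        (fun i hi => by simp [htail i hi]) ⟨r, hr, by simp [htail r hr]⟩

theorem mem_sup_of_mixedRows_succ {I : Ideal (MvPolynomial (Fin n) K)} (hI : IsStronglyStable I)
    {M : Fin n → ℕ → MvPolynomial (Fin n) K} (hM : ∀ i j, (M i j).IsHomogeneous 1) (k : Fin n)
    (hs : RowsSpan (mixedRows M (k + 1))) {V : Submodule K (MvPolynomial (Fin n) K)}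
    (hV : ∀ t ∈ exponents I, distractionMonomial (mixedRows M (k + 1)) t ∈
      V ⊔ restrictSupport K (tailLarger (k + 1) t)) {t : Fin n →₀ ℕ} (ht : t ∈ exponents I) :
    distractionMonomial (mixedRows M k) t ∈ V ⊔ restrictSupport K (tailLarger k t) := by
  have hsum : t.erase k + Finsupp.single k (t k) = t := Finsupp.erase_add_single k t
  have heq : distractionMonomial (mixedRows M k) t =
      distractionMonomial (mixedRows M (k + 1)) (t.erase k) * X k ^ t k := by
    rw [distractionMonomial, distractionMonomial, ← Finset.prod_erase_mul _ _ (Finset.mem_univ k),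
      ← Finset.prod_erase_mul (a := k) _ (fun i => ∏ j ∈ Finset.range (t.erase k i), _)
        (Finset.mem_univ k)]
    simp only [Finsupp.erase_same, Finset.range_zero, Finset.prod_empty, mul_one]
    congr 1
    · refine Finset.prod_congr rfl fun i hi => ?_
      have hik := Finset.ne_of_mem_erase hi
      have hik' : (i : ℕ) ≠ k := fun h => hik (Fin.ext h)
      rw [Finsupp.erase_ne hik]
      refine Finset.prod_congr rfl fun j _ => ?_
      rw [mixedRows, mixedRows]
      exact if_congr (by omega) rfl rfl
    · simp [mixedRows]
  rw [heq]
  refine mul_X_pow_mem_sup hI hM hs hV t (t k) _ (by rwa [hsum]) ?_ fun i hi => ?_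
  · conv_rhs => rw [← hsum, map_add, Finsupp.degree_single]
  · exact Finsupp.erase_ne hi.ne'

/-- Each power product in `I` is, up to smaller power products, in the distraction of `I`. -/
theorem monomial_mem_sup {I : Ideal (MvPolynomial (Fin n) K)} (hI : IsStronglyStable I)
    {M : Fin n → ℕ → MvPolynomial (Fin n) K} (hM : ∀ i j, (M i j).IsHomogeneous 1)
    (hs : ∀ k, RowsSpan (mixedRows M k)) {t : Fin n →₀ ℕ} (ht : t ∈ exponents I) :
    monomial t 1 ∈ Submodule.span K (distractionMonomial M '' exponents I) ⊔
      restrictSupport K (tailLarger 0 t) := by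
  have key : ∀ k ≤ n, ∀ t ∈ exponents I, distractionMonomial (mixedRows M k) t ∈
      Submodule.span K (distractionMonomial M '' exponents I) ⊔
        restrictSupport K (tailLarger k t) := by
    intro k hk
    induction hk using Nat.decreasingInduction with
    | self =>
      intro t ht
      rw [mixedRows_self]
      exact Submodule.mem_sup_left (Submodule.subset_span ⟨t, ht, rfl⟩)
    | of_succ k hk ih =>
      intro t ht
      exact mem_sup_of_mixedRows_succ hI hM ⟨k, hk⟩ (hs _) ih ht
  rw [← mixedRows_zero M t]
  exact key 0 n.zero_le t ht

theorem exists_leading {I : Ideal (MvPolynomial (Fin n) K)} (hI : IsStronglyStable I)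
    {M : Fin n → ℕ → MvPolynomial (Fin n) K} (hM : ∀ i j, (M i j).IsHomogeneous 1)
    (hs : ∀ k, RowsSpan (mixedRows M k)) {t : Fin n →₀ ℕ} (ht : t ∈ exponents I) :
    ∃ f ∈ Submodule.span K (distractionMonomial M '' exponents I),
      coeff t f ≠ 0 ∧ ∀ b ∈ f.support, (degRevLex n).toSyn b ≤ (degRevLex n).toSyn t := by
  -- Here `f` is the power product `t` minus `w`, and all of `w` lies below `t`.
  obtain ⟨f, hf, w, hw, hfw⟩ := Submodule.mem_sup.1 (monomial_mem_sup hI hM hs ht)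
  rw [mem_restrictSupport_iff] at hw
  have hlt : ∀ b, coeff b w ≠ 0 → (degRevLex n).toSyn b < (degRevLex n).toSyn t :=
    fun b hb => toSyn_lt_of_mem_tailLarger (hw (mem_support_iff.2 hb))
  have hcoeff : ∀ b, coeff b f = (if t = b then 1 else 0) - coeff b w := fun b => by
    rw [← coeff_monomial, ← hfw, coeff_add, add_sub_cancel_right]
  refine ⟨f, hf, ?_, fun b hb => ?_⟩
  · have : coeff t w = 0 := by
      by_contra h
      exact lt_irrefl _ (hlt t h)
    simp [hcoeff, this]
  · by_cases hb' : t = b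
    · rw [hb']
    · rw [mem_support_iff, hcoeff, if_neg hb', zero_sub, neg_ne_zero] at hb
      exact (hlt b hb).le

theorem initialIdeal_distractionIdeal {I : Ideal (MvPolynomial (Fin n) K)}
    (hI : IsStronglyStable I) {M : Fin n → ℕ → MvPolynomial (Fin n) K}
    (hM : ∀ i j, (M i j).IsHomogeneous 1) (hs : ∀ k, RowsSpan (mixedRows M k))
    (hM' : RowsSpan M) : initialIdeal (degRevLex n) (distractionIdeal M hM' I) = I := by
  refine le_antisymm (Ideal.span_le.2 ?_)
    (hI.isMonomialIdeal.le_of_exponents_subset fun t ht => ?_)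
  · rintro _ ⟨f, hf, hf0, rfl⟩
    set m := (degRevLex n).degree f with hm
    have hfin : {t ∈ exponents I | t.degree = m.degree}.Finite := by
      refine ((Finset.finsuppAntidiag Finset.univ m.degree).finite_toSet).subset fun t ht => ?_
      rw [Finset.mem_coe, Finset.mem_finsuppAntidiag]
      exact ⟨by rw [← Finsupp.degree_eq_sum]; exact ht.2, Finset.subset_univ _⟩
    -- Passing to the component of degree `m.degree` keeps leading power products of that degree and
    -- makes the dimension count finite.
    have hcomp : ∀ (p : MvPolynomial (Fin n) K) (t : Fin n →₀ ℕ), t.degree = m.degree →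
        coeff t p ≠ 0 → (∀ b ∈ p.support, (degRevLex n).toSyn b ≤ (degRevLex n).toSyn t) →
        coeff t (homogeneousComponent m.degree p) ≠ 0 ∧
          ∀ b ∈ (homogeneousComponent m.degree p).support,
            (degRevLex n).toSyn b ≤ (degRevLex n).toSyn t := by
      intro p t ht h0 hle
      refine ⟨by rwa [coeff_homogeneousComponent, if_pos ht], fun b hb => hle b ?_⟩
      rw [support_homogeneousComponent] at hb
      exact (Finset.mem_filter.1 hb).1
    obtain ⟨h0, hle⟩ := hcomp f m rfl ((degRevLex n).coeff_degree_ne_zero_iff.2 hf0)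
      fun b hb => (degRevLex n).le_degree hb
    refine (mem_of_leading (degRevLex n) hfin (distractionMonomial M) ?_
      (homogeneousComponent_mem_span hM hf m.degree) h0 hle).1
    rintro t ⟨ht, htm⟩
    obtain ⟨p, hp, hp0, hple⟩ := exists_leading hI hM hs ht
    exact ⟨_, homogeneousComponent_mem_span hM hp m.degree, hcomp p t htm hp0 hple⟩
  · obtain ⟨f, hf, hf0, hle⟩ := exists_leading hI hM hs ht
    refine Ideal.subset_span ⟨f, hf, by rintro rfl; simp at hf0, ?_⟩
    congr 2
    exact (degRevLex n).toSyn.injective <| le_antisymm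
      ((degRevLex n).le_degree (mem_support_iff.2 hf0)) ((degRevLex n).degree_le_iff.2 hle)

/-! ## Genericity -/

/-- Multiplying `F` by the determinant of the generic matrix forces a point where the product is
nonzero to be invertible. -/
theorem exists_GL_eval_ne_zero [Infinite K] {F : MvPolynomial (Fin n × Fin n) K} (hF : F ≠ 0) :
    ∃ g : GL (Fin n) K, eval (fun ij => g ij.1 ij.2) F ≠ 0 := by
  have hD (x : Fin n × Fin n → K) :
      eval x (Matrix.of fun i j => (X (i, j) : MvPolynomial (Fin n × Fin n) K)).det =
        (Matrix.of fun i j => x (i, j)).det := by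
    rw [RingHom.map_det]
    congr 1
    ext i j
    simp
  have hD0 : (Matrix.of fun i j => (X (i, j) : MvPolynomial (Fin n × Fin n) K)).det ≠ 0 := by
    intro h
    have := hD fun ij => (1 : Matrix (Fin n) (Fin n) K) ij.1 ij.2
    rw [h, map_zero] at this
    exact one_ne_zero (this.trans Matrix.det_one).symm
  obtain ⟨x, hx⟩ : ∃ x, eval x (F * (Matrix.of fun i j => X (i, j)).det) ≠ 0 := by
    by_contra! h
    exact mul_ne_zero hF hD0 (MvPolynomial.funext fun x => by rw [h x, map_zero])
  rw [map_mul, hD] at hx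
  exact ⟨Matrix.GeneralLinearGroup.mkOfDetNeZero _ (right_ne_zero_of_mul hx),
    left_ne_zero_of_mul hx⟩

theorem IsDistractionMatrix.eq_sum {L : Fin n → ℕ → MvPolynomial (Fin n) K}
    (hL : IsDistractionMatrix L) (i : Fin n) (j : ℕ) :
    L i j = ∑ l, C (coeff (Finsupp.single l 1) (L i j)) * X l := by
  have h := hL.linear i j
  rw [homogeneousSubmodule_one_eq_span_X, Submodule.mem_span_range_iff_exists_fun] at h
  obtain ⟨c, hc⟩ := h
  conv_lhs => rw [← hc]
  refine Finset.sum_congr rfl fun l _ => ?_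
  rw [← hc, coeff_sum, Finset.sum_eq_single l]
  · simp [C_mul']
  · intro r _ hr
    simp [hr, coeff_X, Finsupp.single_left_inj]
  · simp

theorem IsDistractionMatrix.rowsSpan {L : Fin n → ℕ → MvPolynomial (Fin n) K}
    (hL : IsDistractionMatrix L) : RowsSpan L := fun j i => by
  rw [hL.span_eq]
  exact isHomogeneous_X K i

theorem isHomogeneous_linearChange {L : Fin n → ℕ → MvPolynomial (Fin n) K}
    (hL : IsDistractionMatrix L) (g : GL (Fin n) K) (i : Fin n) (j : ℕ) :
    (linearChange g (L i j)).IsHomogeneous 1 := by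
  rw [hL.eq_sum, map_sum]
  refine IsHomogeneous.sum _ _ _ fun l _ => ?_
  rw [map_mul, linearChange, ← algebraMap_eq, AlgHom.commutes, aeval_X, algebraMap_eq]
  exact (IsHomogeneous.sum _ _ _ fun r _ =>
    (isHomogeneous_X K r).C_mul _).C_mul _

/-- The coefficients of the linear forms in the rows of `mixedRows (g L) k` chosen by `j`, as
polynomials in the entries of `g`. -/
noncomputable def mixedMatrix (L : Fin n → ℕ → MvPolynomial (Fin n) K) (k : ℕ) (j : Fin n → ℕ) :
    Matrix (Fin n) (Fin n) (MvPolynomial (Fin n × Fin n) K) :=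
  Matrix.of fun r i => if (r : ℕ) < k then
      ∑ l, C (coeff (Finsupp.single l 1) (L r (j r))) * X (i, l)
    else C ((1 : Matrix (Fin n) (Fin n) K) r i)

theorem mixedRows_linearChange {L : Fin n → ℕ → MvPolynomial (Fin n) K}
    (hL : IsDistractionMatrix L) (k : ℕ) (j : Fin n → ℕ) (g : GL (Fin n) K) (r : Fin n) :
    mixedRows (fun i j => linearChange g (L i j)) k r (j r) =
      ∑ i, eval (fun ij => g ij.1 ij.2) (mixedMatrix L k j r i) • X i := by
  rw [mixedRows]
  split_ifs with h
  · conv_lhs => rw [hL.eq_sum]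
    simp only [mixedMatrix, Matrix.of_apply, if_pos h, map_sum, map_mul, eval_C, eval_X,
      Finset.sum_smul, linearChange, aeval_X, Finset.mul_sum]
    rw [Finset.sum_comm]
    refine Finset.sum_congr rfl fun i _ => Finset.sum_congr rfl fun l _ => ?_
    rw [← algebraMap_eq, AlgHom.commutes, algebraMap_eq, ← mul_assoc, ← C_mul, C_mul']
  · simp [mixedMatrix, h, Matrix.one_apply]

/-- One point of evaluation suffices: the change of coordinates sending each `L r (j r)` to `X r`
makes the mixed matrix the identity, whatever `k` is. -/
theorem det_mixedMatrix_ne_zero {L : Fin n → ℕ → MvPolynomial (Fin n) K}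
    (hL : IsDistractionMatrix L) (k : ℕ) (j : Fin n → ℕ) : (mixedMatrix L k j).det ≠ 0 := by
  have hB : ∀ p, ∃ c : Fin n → K, ∑ r, c r • L r (j r) = X p := fun p =>
    (Submodule.mem_span_range_iff_exists_fun K).1 (hL.rowsSpan j p)
  choose B hB using hB
  let A : Matrix (Fin n) (Fin n) K :=
    Matrix.of fun r l => coeff (Finsupp.single l 1) (L r (j r))
  have hBA : Matrix.of B * A = 1 := by
    ext p l
    have := congrArg (coeff (Finsupp.single l 1)) (hB p)
    rw [coeff_sum, coeff_X] at this
    simpa [Matrix.mul_apply, A, Matrix.one_apply, Finsupp.single_left_inj] using this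
  have hAB : A * Matrix.of B = 1 := mul_eq_one_comm.1 hBA
  intro h
  -- The evaluation point is the transpose of `B`, since the matrix of a coordinate change stores
  -- the image of `X l` in its column `l`.
  have h1 := congrArg (eval fun il : Fin n × Fin n => B il.2 il.1) h
  rw [map_zero, RingHom.map_det] at h1
  have h2 : (eval fun il : Fin n × Fin n => B il.2 il.1).mapMatrix (mixedMatrix L k j) = 1 := by
    ext r i
    have := congrFun (congrFun hAB r) i
    simp only [Matrix.mul_apply, A, Matrix.of_apply] at this
    by_cases hr : (r : ℕ) < k <;> simp [mixedMatrix, hr, this]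
  rw [h2, Matrix.det_one] at h1
  exact one_ne_zero h1

theorem rowsSpan_mixedRows {L : Fin n → ℕ → MvPolynomial (Fin n) K}
    (hL : IsDistractionMatrix L) {k : ℕ} {j : Fin n → ℕ} {g : GL (Fin n) K}
    (h : eval (fun ij => g ij.1 ij.2) (mixedMatrix L k j).det ≠ 0) (p : Fin n) :
    X p ∈ Submodule.span K
      (Set.range fun r => mixedRows (fun i j => linearChange g (L i j)) k r (j r)) := by
  rw [Submodule.mem_span_range_iff_exists_fun]
  rw [RingHom.map_det] at h
  set A := (eval fun ij : Fin n × Fin n => g ij.1 ij.2).mapMatrix (mixedMatrix L k j) with hA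
  refine ⟨fun r => A⁻¹ p r, ?_⟩
  simp_rw [mixedRows_linearChange hL, Finset.smul_sum, smul_smul]
  rw [Finset.sum_comm]
  simp_rw [← Finset.sum_smul]
  have hmul : ∀ i, ∑ r, A⁻¹ p r * eval (fun ij => g ij.1 ij.2) (mixedMatrix L k j r i) =
      (1 : Matrix (Fin n) (Fin n) K) p i := fun i => by
    rw [← Matrix.nonsing_inv_mul A (isUnit_iff_ne_zero.2 h), Matrix.mul_apply]
    rfl
  simp [hmul, Matrix.one_apply]

theorem forGeneric_rowsSpan_mixedRows [Infinite K] {L : Fin n → ℕ → MvPolynomial (Fin n) K}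
    (hL : IsDistractionMatrix L) : ForGeneric fun g : GL (Fin n) K =>
      ∀ k, RowsSpan (mixedRows (fun i j => linearChange g (L i j)) k) := by
  obtain ⟨N, hN⟩ := hL.eventually_const
  refine ⟨∏ k : Fin (n + 1), ∏ j : Fin n → Fin (N + 1), (mixedMatrix L k fun r => j r).det,
    exists_GL_eval_ne_zero ?_, fun g hg k j p => ?_⟩
  · exact Finset.prod_ne_zero_iff.2 fun k _ => Finset.prod_ne_zero_iff.2 fun j _ =>
      det_mixedMatrix_ne_zero hL _ _
  · simp only [map_prod, Finset.prod_ne_zero_iff, Finset.mem_univ, true_implies] at hg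
    -- For `k > n` the mixed rows are those for `n`, and columns beyond `N` repeat column `N`, so
    -- each condition reduces to one of the finitely many factors.
    have := rowsSpan_mixedRows hL (hg ⟨min k n, by omega⟩ fun r => ⟨min (j r) N, by omega⟩) p
    convert this using 4 with r
    have hLj : L r (j r) = L r (min (j r) N) := by
      rcases le_or_gt (j r) N with h | h
      · rw [min_eq_left h]
      · rw [min_eq_right h.le, hN r _ h]
    rw [mixedRows, mixedRows, hLj]
    exact if_congr (by have := r.2; simp only; omega) rfl rfl

end GinDistraction

theorem mainTheorem1 {K : Type*} [Field K] [Infinite K] (n : ℕ)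
    (I : Ideal (MvPolynomial (Fin n) K)) (hI : GinDistraction.IsStronglyStable I)
    (L : Fin n → ℕ → MvPolynomial (Fin n) K) (hL : GinDistraction.IsDistractionMatrix L) :
    ∃ J : Ideal (MvPolynomial (Fin n) K),
      J.restrictScalars K = (I.restrictScalars K).map (GinDistraction.distraction L) ∧
      (∀ f ∈ J, ∀ d : ℕ, MvPolynomial.homogeneousComponent d f ∈ J) ∧
      GinDistraction.IsGenericInitialIdeal (GinDistraction.degRevLex n) J I := by
  open GinDistraction in
  refine ⟨distractionIdeal L hL.rowsSpan I, (map_distraction hI.isMonomialIdeal L).symm,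
    fun f hf d => homogeneousComponent_mem_distractionIdeal hL.linear hf d, ?_⟩
  obtain ⟨F, hF, h⟩ := forGeneric_rowsSpan_mixedRows hL
  refine ⟨F, hF, fun g hg => ?_⟩
  have hM : RowsSpan fun i j => linearChange g (L i j) := by
    have := h g hg n
    rwa [mixedRows_self] at this
  beta_reduce
  rw [map_distractionIdeal g hL.rowsSpan hM]
  exact initialIdeal_distractionIdeal hI (isHomogeneous_linearChange hL g) (h g hg) hM
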